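/- Let $N\ge 1$, $K\ge 0$ and $\bar n_1,\dots,\bar n_K\ge 1$ be integers, $\sigma>0$, and $p_1,\dots,p_K>0$ real numbers, with the users numbered so that $p_1/\bar n_1\ge p_2/\bar n_2\ge\dots\ge p_K/\bar n_K$. Consider the multi-code CDMA system with $K$ users, processing gain $N$ and noise variance $\sigma^2$ per dimension, in which user $k$ has power $p_k$ and at most $\bar n_k$ data streams. A power distribution $(p_{k,l})_{1\le k\le K,\,1\le l\le\bar n_k}$ is feasible if $p_{k,l}\ge 0$ and $\sum_{l=1}^{\bar n_k}p_{k,l}=p_k$ for all $k$. Together with signature sequences $s_{k,l}\in\mathbb R^N$, $\|s_{k,l}\|^2=N$, it has the sum rate $$\frac1{2N}\log_2\det\Big(I_N+\frac1{\sigma^2}\sum_{k=1}^{K}\sum_{l=1}^{\bar n_k}p_{k,l}\,s_{k,l}s_{k,l}^T\Big).$$ A feasible power distribution is called optimal if, together with some signature sequences, it maximizes the sum rate over all feasible power distributions and all signature sequences. Its number of active data streams of user $k$ is the number of $l$ with $p_{k,l}>0$. User $k$ is called undersized if $\hat n_k<\bar n_k$, where $\hat n_k=\big(N-\sum_{k'<k}\bar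 n_{k'}\big)\,p_k/\sum_{k'\ge k}p_{k'}$. Let $K_2$ be the number of users that are not undersized, and put $$w_k^*=\frac{\bar n_k}{2N}\ \ (k\le K_2),\qquad w_k^*=\frac1{2N}\Big(N-\sum_{k'\le K_2}\bar n_{k'}\Big)\frac{p_k}{\sum_{k'>K_2}p_{k'}}\ \ (k>K_2).$$ Call $(w_{k,l}^*)_{1\le k\le K,\,1\le l\le\bar n_k}$ an optimal bandwidth profile if it maximizes $$\sum_{k=1}^K\sum_{l=1}^{\bar n_k}w_{k,l}\log_2\Big(1+\frac{p_k}{2\sigma^2\sum_{l'=1}^{\bar n_k}w_{k,l'}}\Big)\quad\text{subject to}\quad 0\le w_{k,l}\le\frac1{2N}\ \ (\forall k,l),\qquad \sum_{k=1}^K\sum_{l=1}^{\bar n_k}w_{k,l}\le\frac12,$$ where the terms of a user with $\sum_{l'}w_{k,l'}=0$ are $0$. Then: 1. A profile $(w_{k,l})$ is an optimal bandwidth profile if and only if $0\le w_{k,l}\le\frac1{2N}$ for all $k,l$ and $\sum_{l=1}^{\bar n_k}w_{k,l}=w_k^*$ for all $k$. 2. A family $(p_{k,l}^*)$ of real numbers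 is an optimal power distribution if and only if there is an optimal bandwidth profile $(w_{k,l}^*)$ such that, for all $k$ and all $l\in\{1,\dots,\bar n_k\}$, $$p_{k,l}^*=\frac{p_k}{\bar n_k}\ \text{ if } k\le K_2,\qquad p_{k,l}^*=\frac{w_{k,l}^*}{w_k^*}\,p_k\ \text{ if } k>K_2.$$ 3. For every optimal power distribution, the number $n_k^*$ of active data streams of user $k$ is $\bar n_k$ if $k\le K_2$, and $\sum_{l=1}^{\bar n_k}\mathrm{sgn}(p_{k,l}^*)$ if $k>K_2$. -/

import Mathlib

noncomputable section

/-- Index set of the data streams (virtual single-code users): pairs `(k, l)` of a user `k` and one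
of its `n k` streams `l`. -/
abbrev StreamIndex {K : ℕ} (n : Fin K → ℕ) : Type := (k : Fin K) × Fin (n k)

/-- A power distribution gives the power `P k l` of the `l`-th stream of the `k`-th user. It is
feasible when all powers are non-negative and the streams of user `k` use the power `p k` in total. -/
def FeasiblePower {K : ℕ} (n : Fin K → ℕ) (p : Fin K → ℝ)
    (P : (k : Fin K) → Fin (n k) → ℝ) : Prop :=
  (∀ k l, 0 ≤ P k l) ∧ ∀ k, ∑ l, P k l = p k

/-- The signature sequences are the columns of the `N`-row matrix `S`, each of energy
(squared Euclidean norm) `N`. -/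
def FeasibleSignatures {K : ℕ} (N : ℕ) (n : Fin K → ℕ)
    (S : Matrix (Fin N) (StreamIndex n) ℝ) : Prop :=
  ∀ j, ∑ i, S i j ^ 2 = (N : ℝ)

/-- Sum rate `(1 / (2 N)) log₂ det (I + σ⁻² S P Sᵀ)` in bits per chip. -/
def sumRate {K : ℕ} (N : ℕ) (n : Fin K → ℕ) (σ : ℝ)
    (P : (k : Fin K) → Fin (n k) → ℝ) (S : Matrix (Fin N) (StreamIndex n) ℝ) : ℝ :=
  1 / (2 * (N : ℝ)) *
    Real.logb 2
      (1 + (1 / σ ^ 2) • (S * Matrix.diagonal (fun j : StreamIndex n => P j.1 j.2) * S.transpose)).det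

/-- `(P, S)` maximizes the sum rate among all feasible pairs. -/
def IsOptimalSystem {K : ℕ} (N : ℕ) (n : Fin K → ℕ) (p : Fin K → ℝ) (σ : ℝ)
    (P : (k : Fin K) → Fin (n k) → ℝ) (S : Matrix (Fin N) (StreamIndex n) ℝ) : Prop :=
  FeasiblePower n p P ∧ FeasibleSignatures N n S ∧
    ∀ P' S', FeasiblePower n p P' → FeasibleSignatures N n S' →
      sumRate N n σ P' S' ≤ sumRate N n σ P S

/-- `P` is an optimal power distribution: jointly with suitable signature sequences it achieves
the maximum sum rate. -/
def IsOptimalPower {K : ℕ} (N : ℕ) (n : Fin K → ℕ) (p : Fin K → ℝ) (σ : ℝ)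
    (P : (k : Fin K) → Fin (n k) → ℝ) : Prop :=
  ∃ S, IsOptimalSystem N n p σ P S

/-- The number of active data streams of user `k`, i.e. those of positive power. -/
def activeStreams {K : ℕ} (n : Fin K → ℕ) (P : (k : Fin K) → Fin (n k) → ℝ) (k : Fin K) : ℕ :=
  Nat.card {l : Fin (n k) // 0 < P k l}

/-- The quantity `(N - ∑_{k' < k} n k') * p k / ∑_{k' ≥ k} p k'` that classifies user `k`. -/
def nHat {K : ℕ} (N : ℕ) (n : Fin K → ℕ) (p : Fin K → ℝ) (k : Fin K) : ℝ :=
  ((N : ℝ) - ∑ k' ∈ Finset.Iio k, (n k' : ℝ)) * (p k / ∑ k' ∈ Finset.Ici k, p k')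

/-- User `k` is undersized. -/
def IsUndersized {K : ℕ} (N : ℕ) (n : Fin K → ℕ) (p : Fin K → ℝ) (k : Fin K) : Prop :=
  nHat N n p k < (n k : ℝ)

/-- The number of non-undersized users. -/
def K₂ {K : ℕ} (N : ℕ) (n : Fin K → ℕ) (p : Fin K → ℝ) : ℕ :=
  Nat.card {k : Fin K // ¬ IsUndersized N n p k}

/-- Feasible profiles of FDMA-equivalent bandwidths: every stream gets at most `1 / (2 N)`, and all
streams together at most `1 / 2`. -/
def FeasibleBandwidth {K : ℕ} (N : ℕ) (n : Fin K → ℕ)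
    (w : (k : Fin K) → Fin (n k) → ℝ) : Prop :=
  (∀ k l, 0 ≤ w k l ∧ w k l ≤ 1 / (2 * (N : ℝ))) ∧ ∑ k, ∑ l, w k l ≤ 1 / 2

/-- The objective `∑_{k,l} w_{k,l} log₂ (1 + p_k / (2 σ² ∑_{l'} w_{k,l'}))`; on feasible profiles a
user without bandwidth contributes `0`. -/
def bandwidthRate {K : ℕ} (n : Fin K → ℕ) (p : Fin K → ℝ) (σ : ℝ)
    (w : (k : Fin K) → Fin (n k) → ℝ) : ℝ :=
  ∑ k, ∑ l, w k l * Real.logb 2 (1 + p k / (2 * σ ^ 2 * ∑ l', w k l'))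

/-- `w` maximizes `bandwidthRate` among all feasible profiles. -/
def IsOptimalBandwidth {K : ℕ} (N : ℕ) (n : Fin K → ℕ) (p : Fin K → ℝ) (σ : ℝ)
    (w : (k : Fin K) → Fin (n k) → ℝ) : Prop :=
  FeasibleBandwidth N n w ∧
    ∀ w', FeasibleBandwidth N n w' → bandwidthRate n p σ w' ≤ bandwidthRate n p σ w

/-- The optimal FDMA-equivalent bandwidth `w_k*` of user `k`; users are numbered from `0`, so that
`k < K₂` singles out the first `K₂` users. -/
def wStar {K : ℕ} (N : ℕ) (n : Fin K → ℕ) (p : Fin K → ℝ) (k : Fin K) : ℝ :=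
  if (k : ℕ) < K₂ N n p then (n k : ℝ) / (2 * (N : ℝ))
  else 1 / (2 * (N : ℝ)) *
    ((N : ℝ) - ∑ k' ∈ Finset.univ.filter (fun i : Fin K => (i : ℕ) < K₂ N n p), (n k' : ℝ)) *
    (p k / ∑ k' ∈ Finset.univ.filter (fun i : Fin K => K₂ N n p ≤ (i : ℕ)), p k')

end

/-! ### Determinant bound for triangular signature matrices -/

section

open Matrix

/-! Everything is governed by one level per user, a power per dimension: `p k / n k` for the
saturated users `k < K₂`, and the common value τ = `tailPower / tailDim` for the rest. The ordering
of the ratios makes τ lie between the saturated and the unsaturated ratios, and `wStar` is `p k / (2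
N level)`.

The core is `isOptimalPower_iff`: a feasible power distribution is optimal exactly when no stream
exceeds its user's level. For the upper bound, space is rotated so that a signature has no component
in dimensions of lower level than its own. Rescaling the dimensions by the target eigenvalues then
gives a matrix of trace at most `N`, and AM-GM bounds its determinant by 1. Equality makes the
received covariance diagonal, and its quadratic form at a signature bounds the power of that stream.
Conversely, under the level caps each saturated stream gets a dimension of its own, and the
carpenter theorem spreads the others evenly over the `tailDim` remaining dimensions.

The bandwidth problem is concave: the tangents at `wStar`, compared with the marginal value of
bandwidth at level τ, show that the user totals are optimal and unique. Since `wStar` is `p k / (2 N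
level)`, the cap `1 / (2 N)` on a stream's bandwidth is the level cap on its power, which links the
two problems. -/

/-- AM-GM for the eigenvalues of a positive definite matrix. -/
theorem det_le_one_of_trace_le_card {ι : Type*} [Fintype ι] [DecidableEq ι] {C : Matrix ι ι ℝ}
    (hC : C.PosDef) (ht : C.trace ≤ Fintype.card ι) :
    C.det ≤ 1 ∧ (C.det = 1 → C = 1) := by
  have hpos := hC.eigenvalues_pos
  have hdet : C.det = ∏ i, hC.1.eigenvalues i := by
    simpa using hC.1.det_eq_prod_eigenvalues
  have htr : C.trace = ∑ i, hC.1.eigenvalues i := by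
    simpa using hC.1.trace_eq_sum_eigenvalues
  have hlog : Real.log C.det = ∑ i, Real.log (hC.1.eigenvalues i) := by
    rw [hdet, Real.log_prod (fun i _ => (hpos i).ne')]
  have hle : ∀ i, Real.log (hC.1.eigenvalues i) ≤ hC.1.eigenvalues i - 1 := fun i =>
    Real.log_le_sub_one_of_pos (hpos i)
  have hsum : ∑ i, (hC.1.eigenvalues i - 1) ≤ 0 := by
    rw [Finset.sum_sub_distrib, ← htr]
    simpa using ht
  have hsl := Finset.sum_le_sum fun i (_ : i ∈ Finset.univ) => hle i
  refine ⟨?_, fun h1 => ?_⟩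
  · have : Real.log C.det ≤ 0 := by rw [hlog]; exact hsl.trans hsum
    by_contra! h
    exact absurd (Real.log_pos h) (not_lt.2 this)
  · rw [h1, Real.log_one] at hlog
    have heq : ∀ i, hC.1.eigenvalues i = 1 := by
      by_contra! hne
      obtain ⟨i, hi⟩ := hne
      have := Finset.sum_lt_sum (fun i (_ : i ∈ Finset.univ) => hle i)
        ⟨i, Finset.mem_univ i, Real.log_lt_sub_one_of_pos (hpos i) hi⟩
      linarith
    have hs := hC.1.spectral_theorem
    have : (RCLike.ofReal ∘ hC.1.eigenvalues : ι → ℝ) = fun _ => 1 := by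
      funext i; simp [heq i]
    rw [this] at hs
    rw [hs]
    simp

/-- A family of vectors is triangular in a suitable orthonormal basis, with respect to any
prescribed ranking `h` of the indices. -/
theorem exists_orthonormalBasis_triangular {ι E : Type*} [Fintype ι] [NormedAddCommGroup E]
    [InnerProductSpace ℝ E] [FiniteDimensional ℝ E]
    (hcard : Module.finrank ℝ E = Fintype.card ι) (h : ι → ℝ) (v : ι → E) :
    ∃ e : OrthonormalBasis ι ℝ E, ∀ i j, h i < h j → inner ℝ (e i) (v j) = 0 := by
  -- Gram-Schmidt runs through the indices by decreasing `h`; the enumeration only breaks ties.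
  let g : ι → ℝᵒᵈ ×ₗ Fin (Fintype.card ι) := fun i =>
    toLex (OrderDual.toDual (h i), Fintype.equivFin ι i)
  have hg : Function.Injective g := fun i j hij => by
    have := congrArg (fun x => (ofLex x).2) hij
    simpa [g] using this
  let _ : LinearOrder ι := LinearOrder.lift' g hg
  let _ : LocallyFiniteOrderBot ι := 
    { finsetIic := fun a => Finset.univ.filter (· ≤ a)
      finsetIio := fun a => Finset.univ.filter (· < a)
      finset_mem_Iic := by simp
      finset_mem_Iio := by simp }
  refine ⟨InnerProductSpace.gramSchmidtOrthonormalBasis hcard v, fun i j hij => ?_⟩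
  apply InnerProductSpace.gramSchmidtOrthonormalBasis_inv_triangular
  change g j < g i
  simp only [g, Prod.Lex.toLex_lt_toLex]
  exact Or.inl hij

theorem posDef_one_add_smul {ι J : Type*} [Fintype ι] [DecidableEq ι] [Fintype J] [DecidableEq J]
    {a : ℝ} (ha : 0 ≤ a) {P : J → ℝ} (hP : ∀ j, 0 ≤ P j) (T : Matrix ι J ℝ) :
    (1 + a • (T * diagonal P * Tᵀ)).PosDef := by
  refine PosDef.one.add_posSemidef (PosSemidef.smul ?_ ha)
  have := (posSemidef_diagonal_iff.2 hP).mul_mul_conjTranspose_same T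
  rwa [conjTranspose_eq_transpose_of_trivial] at this

/-- If the signature matrix `T`, with columns of energy `s`, is triangular with respect to the levels
`h` of the rows and `ν` of the columns, then the determinant is at most the one of the diagonal
matrix with the entries `1 + a s h i`, and equality forces `P ≤ ν`. -/
theorem det_le_prod_of_triangular {ι J : Type*} [Fintype ι] [DecidableEq ι] [Fintype J]
    [DecidableEq J] {a s : ℝ} (ha : 0 < a) (hs : 0 < s) {h : ι → ℝ} {P ν : J → ℝ}
    (hh : ∀ i, 0 ≤ h i) (hP : ∀ j, 0 ≤ P j) (hν : ∀ j, 0 ≤ ν j) {T : Matrix ι J ℝ}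
    (hT : ∀ j, ∑ i, T i j ^ 2 = s) (htri : ∀ i j, T i j ≠ 0 → ν j ≤ h i)
    (hbal : ∑ j, P j / (1 + a * s * ν j) = ∑ i, h i / (1 + a * s * h i)) :
    (1 + a • (T * diagonal P * Tᵀ)).det ≤ ∏ i, (1 + a * s * h i) ∧
      ((1 + a • (T * diagonal P * Tᵀ)).det = ∏ i, (1 + a * s * h i) → ∀ j, P j ≤ ν j) := by
  set M := 1 + a • (T * diagonal P * Tᵀ) with hM
  have hMij : ∀ i i', M i i' = (1 : Matrix ι ι ℝ) i i' + a * ∑ j, P j * T i j * T i' j := by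
    intro i i'
    simp only [hM, Matrix.add_apply, Matrix.smul_apply, smul_eq_mul]
    congr 2
    exact Finset.sum_congr rfl fun j _ => by
      change (T * diagonal P) i j * Tᵀ j i' = _
      rw [mul_diagonal, transpose_apply, mul_comm (P j)]
  have hMpos : M.PosDef := posDef_one_add_smul ha.le hP T
  have hd : ∀ i, 0 < 1 + a * s * h i := fun i => by have := hh i; positivity
  have hdν : ∀ j, 0 < 1 + a * s * ν j := fun j => by have := hν j; positivity
  -- This scaling turns the extremal matrix `diagonal (1 + a s h)` into the identity.
  set r : ι → ℝ := fun i => 1 / √(1 + a * s * h i) with hr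
  have hrr : ∀ i, r i * r i = 1 / (1 + a * s * h i) := fun i => by
    rw [hr, div_mul_div_comm, one_mul, Real.mul_self_sqrt (hd i).le]
  have hrpos : ∀ i, 0 < r i := fun i => by have := Real.sqrt_pos.2 (hd i); simp only [hr]; positivity
  set C := diagonal r * M * diagonal r with hCdef
  have hCij : ∀ i i', C i i' = r i * M i i' * r i' := fun i i' => by
    simp [hCdef, mul_diagonal, diagonal_mul]
  have hC : C.PosDef := by
    have := hMpos.mul_mul_conjTranspose_same (B := diagonal r) (by
      refine vecMul_injective_of_isUnit ?_
      rw [isUnit_iff_isUnit_det, det_diagonal]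
      exact (Finset.prod_pos fun i _ => hrpos i).ne'.isUnit)
    rwa [conjTranspose_eq_transpose_of_trivial, diagonal_transpose] at this
  have hCdet : C.det * ∏ i, (1 + a * s * h i) = M.det := by
    have h1 : (∏ i, r i) * (∏ i, r i) * ∏ i, (1 + a * s * h i) = 1 := by
      rw [← Finset.prod_mul_distrib, ← Finset.prod_mul_distrib]
      exact Finset.prod_eq_one fun i _ => by rw [hrr, one_div_mul_cancel (hd i).ne']
    rw [hCdef, det_mul, det_mul, det_diagonal]
    linear_combination M.det * h1
  have hprod : 0 < ∏ i, (1 + a * s * h i) := Finset.prod_pos fun i _ => hd i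
  have hterm : ∀ i j, P j * (T i j ^ 2 / (1 + a * s * h i)) ≤ P j * (T i j ^ 2 / (1 + a * s * ν j)) := by
    intro i j
    refine mul_le_mul_of_nonneg_left ?_ (hP j)
    by_cases h0 : T i j = 0
    · simp [h0]
    · have := htri i j h0
      have := hdν j
      gcongr
  have htrace : C.trace = ∑ i, 1 / (1 + a * s * h i)
      + a * ∑ i, ∑ j, P j * (T i j ^ 2 / (1 + a * s * h i)) := by
    rw [trace, Finset.mul_sum, ← Finset.sum_add_distrib]
    refine Finset.sum_congr rfl fun i _ => ?_
    rw [diag_apply, hCij, mul_right_comm, hrr, hMij, one_apply_eq, mul_add, mul_one, Finset.mul_sum,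
      Finset.mul_sum, Finset.mul_sum]
    congr 1
    exact Finset.sum_congr rfl fun j _ => by ring
  -- With `ν` in place of `h` the column energies sum to `s`, and `hbal` makes row `i` contribute 1
  -- in total.
  have hbound : ∑ i, 1 / (1 + a * s * h i) + a * ∑ i, ∑ j, P j * (T i j ^ 2 / (1 + a * s * ν j))
      = Fintype.card ι := by
    have h1 : ∑ i, ∑ j, P j * (T i j ^ 2 / (1 + a * s * ν j)) = s * ∑ j, P j / (1 + a * s * ν j) := by
      rw [Finset.sum_comm, Finset.mul_sum]
      refine Finset.sum_congr rfl fun j _ => ?_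
      rw [← Finset.mul_sum, ← Finset.sum_div, hT]
      ring
    rw [h1, hbal, ← mul_assoc, Finset.mul_sum, ← Finset.sum_add_distrib]
    rw [Finset.sum_congr rfl (g := fun _ => (1 : ℝ))]
    · simp
    · intro i _
      have := (hd i).ne'
      field_simp
  have hdle := Finset.sum_le_sum fun i (_ : i ∈ Finset.univ) =>
    Finset.sum_le_sum fun j (_ : j ∈ Finset.univ) => hterm i j
  have htrle : C.trace ≤ Fintype.card ι := by
    rw [htrace, ← hbound]
    gcongr 1
    exact mul_le_mul_of_nonneg_left hdle ha.le
  obtain ⟨hC1, hC2⟩ := det_le_one_of_trace_le_card hC htrle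
  refine ⟨?_, fun heq j => ?_⟩
  · rw [← hCdet]
    exact mul_le_of_le_one_left hprod.le hC1
  · have hCone : C = 1 := hC2 (by
      rw [← heq, ← hCdet] at hprod
      rw [← hCdet] at heq
      exact (mul_eq_right₀ (by rintro h0; simp [h0] at hprod)).1 heq)
    have hMdiag : ∀ i i', a * ∑ j, P j * T i j * T i' j = if i = i' then a * s * h i else 0 := by
      intro i i'
      have h1 := hCij i i'
      rw [hCone, hMij] at h1
      split_ifs with hii
      · subst hii
        rw [one_apply_eq, mul_right_comm, hrr] at h1
        rw [one_div_mul_eq_div, eq_div_iff (hd i).ne'] at h1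
        linarith
      · rw [one_apply_ne hii, zero_add] at h1
        rcases mul_eq_zero.1 h1.symm with h2 | h2
        · exact (mul_eq_zero.1 h2).resolve_left (hrpos i).ne'
        · exact absurd h2 (hrpos i').ne'
    rcases (hP j).eq_or_lt with hj | hj
    · rw [← hj]; exact hν j
    have htight : ∀ i, T i j ≠ 0 → h i = ν j := by
      intro i hij
      have hsumeq : ∑ i, ∑ j, P j * (T i j ^ 2 / (1 + a * s * h i))
          = ∑ i, ∑ j, P j * (T i j ^ 2 / (1 + a * s * ν j)) := by
        have h1 : C.trace = Fintype.card ι := by rw [hCone]; simp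
        rw [htrace, ← hbound] at h1
        exact mul_left_cancel₀ ha.ne' (add_left_cancel h1)
      have h2 := (Finset.sum_eq_sum_iff_of_le fun i _ =>
        Finset.sum_le_sum fun j (_ : j ∈ Finset.univ) => hterm i j).1 hsumeq i (Finset.mem_univ i)
      have h3 := (Finset.sum_eq_sum_iff_of_le fun j _ => hterm i j).1 h2 j (Finset.mem_univ j)
      have h4 := mul_left_cancel₀ hj.ne' h3
      have h5 : T i j ^ 2 ≠ 0 := pow_ne_zero 2 hij
      have h6 := (hd i).ne'
      have h7 := (hdν j).ne'
      field_simp at h4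
      have h8 : a * s ≠ 0 := (mul_pos ha hs).ne'
      exact mul_left_cancel₀ h8 (by linarith)
    -- The quadratic form of `T P Tᵀ` at column `j` is computed twice: from its diagonal form here,
    -- and below as a sum of non-negative terms, of which stream `j` contributes `P j * s ^ 2`.
    have hquad : ∑ i, ∑ i', T i j * T i' j * (∑ j', P j' * T i j' * T i' j') = s * s * ν j := by
      have h1 : ∀ i i', ∑ j', P j' * T i j' * T i' j' = if i = i' then s * h i else 0 := by
        intro i i'
        apply mul_left_cancel₀ ha.ne'
        rw [hMdiag]
        split_ifs <;> ring
      simp only [h1, mul_ite, mul_zero, Finset.sum_ite_eq, Finset.mem_univ, if_true]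
      rw [← hT j, Finset.sum_mul, Finset.sum_mul, hT j]
      refine Finset.sum_congr rfl fun i _ => ?_
      by_cases h0 : T i j = 0
      · simp [h0]
      · rw [htight i h0]; ring
    have hquad' : ∑ i, ∑ i', T i j * T i' j * (∑ j', P j' * T i j' * T i' j')
        = ∑ j', P j' * (∑ i, T i j * T i j') ^ 2 := by
      simp only [Finset.mul_sum, sq, Finset.sum_mul]
      rw [Finset.sum_congr rfl fun i _ => Finset.sum_comm, Finset.sum_comm]
      refine Finset.sum_congr rfl fun j' _ => Finset.sum_congr rfl fun i _ =>
        Finset.sum_congr rfl fun i' _ => by ring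
    have hsingle : P j * (∑ i, T i j * T i j) ^ 2 ≤ ∑ j', P j' * (∑ i, T i j * T i j') ^ 2 :=
      Finset.single_le_sum (f := fun j' => P j' * (∑ i, T i j * T i j') ^ 2)
        (fun j' _ => mul_nonneg (hP j') (sq_nonneg _)) (Finset.mem_univ j)
    have hTT : ∑ i, T i j * T i j = s := by rw [← hT j]; simp [sq]
    rw [← hquad', hquad, hTT] at hsingle
    have : 0 < s * s := mul_pos hs hs
    nlinarith

end

/-! ### The finite carpenter theorem -/

section

open Matrix

/-- A plane rotation of two columns keeps the rows orthonormal and moves the energies of the two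
columns towards each other. -/
theorem exists_rows_orthonormal_of_rotation {ι J : Type*} [Fintype ι] [DecidableEq ι] [Fintype J]
    [DecidableEq J] {V : Matrix ι J ℝ} (hV : V * Vᵀ = 1) {a : J → ℝ} {x y : J} (hxy : x ≠ y)
    (hsum : a x + a y = ∑ i, V i x ^ 2 + ∑ i, V i y ^ 2)
    (hother : ∀ j, j ≠ x → j ≠ y → ∑ i, V i j ^ 2 = a j)
    (hmem : a x ∈ Set.Icc (∑ i, V i y ^ 2) (∑ i, V i x ^ 2)) :
    ∃ W : Matrix ι J ℝ, W * Wᵀ = 1 ∧ ∀ j, ∑ i, W i j ^ 2 = a j := by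
  -- Energy of the rotated column `x`. A quarter turn takes it to the energy of column `y`, so every
  -- value between is attained; column `y` receives the remainder.
  let f : ℝ → ℝ := fun t => ∑ i, (Real.cos t * V i x + Real.sin t * V i y) ^ 2
  have hf : Continuous f := by fun_prop
  have hf0 : f 0 = ∑ i, V i x ^ 2 := by simp [f]
  have hf1 : f (Real.pi / 2) = ∑ i, V i y ^ 2 := by simp [f]
  obtain ⟨t, -, ht⟩ : a x ∈ f '' Set.Icc 0 (Real.pi / 2) :=
    intermediate_value_Icc' (by positivity) hf.continuousOn (by rwa [hf0, hf1])
  have hcs := Real.sin_sq_add_cos_sq t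
  let W : Matrix ι J ℝ := fun i j =>
    if j = x then Real.cos t * V i x + Real.sin t * V i y
    else if j = y then -Real.sin t * V i x + Real.cos t * V i y else V i j
  have hWx : ∀ i, W i x = Real.cos t * V i x + Real.sin t * V i y := fun i => by simp [W]
  have hWy : ∀ i, W i y = -Real.sin t * V i x + Real.cos t * V i y := fun i => by
    simp [W, hxy.symm]
  have hWo : ∀ i j, j ≠ x → j ≠ y → W i j = V i j := fun i j h1 h2 => by simp [W, h1, h2]
  refine ⟨W, ?_, fun j => ?_⟩
  · rw [← hV]
    ext i i'
    rw [mul_apply, mul_apply, ← sub_eq_zero, ← Finset.sum_sub_distrib,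
      Fintype.sum_eq_add x y hxy]
    · simp only [transpose_apply, hWx, hWy]
      linear_combination (V i x * V i' x + V i y * V i' y) * hcs
    · rintro j ⟨h1, h2⟩
      simp [transpose_apply, hWo _ j h1 h2]
  · by_cases h1 : j = x
    · subst h1
      simp only [hWx]
      exact ht
    by_cases h2 : j = y
    · subst h2
      have h3 : ∑ i, W i x ^ 2 + ∑ i, W i j ^ 2 = ∑ i, V i x ^ 2 + ∑ i, V i j ^ 2 := by
        rw [← Finset.sum_add_distrib, ← Finset.sum_add_distrib]
        refine Finset.sum_congr rfl fun i _ => ?_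
        rw [hWx, hWy]
        linear_combination (V i x ^ 2 + V i j ^ 2) * hcs
      have h4 : ∑ i, W i x ^ 2 = a x := by simp only [hWx]; exact ht
      linarith
    · simp only [hWo _ j h1 h2]
      exact hother j h1 h2

/-- The finite carpenter theorem: numbers in `[0, 1]` that add up to an integer `R` are the column
energies of a matrix with `R` orthonormal rows. -/
theorem exists_rows_orthonormal_of_column_energies {J : Type*} [Fintype J] [DecidableEq J] (R : ℕ)
    (a : J → ℝ) (h0 : ∀ j, 0 ≤ a j) (h1 : ∀ j, a j ≤ 1) (hsum : ∑ j, a j = R) :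
    ∃ V : Matrix (Fin R) J ℝ, V * Vᵀ = 1 ∧ ∀ j, ∑ i, V i j ^ 2 = a j := by
  -- Induction on the number of fractional entries. With none left, the rows are standard unit
  -- vectors.
  induction hm : (Finset.univ.filter fun j => a j ≠ 0 ∧ a j ≠ 1).card using
    Nat.strong_induction_on generalizing a with
  | _ m ih =>
  by_cases hint : ∀ j, a j = 0 ∨ a j = 1
  · have hcard : Fintype.card {j // a j = 1} = R := by
      have h2 : ∑ j, a j = ∑ j, if a j = 1 then (1 : ℝ) else 0 :=
        Finset.sum_congr rfl fun j _ => by rcases hint j with h | h <;> simp [h]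
      rw [hsum, Finset.sum_boole] at h2
      rw [Fintype.card_subtype]
      exact_mod_cast h2.symm
    let e : {j // a j = 1} ≃ Fin R := Fintype.equivFinOfCardEq hcard
    refine ⟨of fun i j => if (e.symm i : J) = j then 1 else 0, ?_, fun j => ?_⟩
    · ext i i'
      simp [mul_apply, one_apply, Subtype.coe_inj, eq_comm]
    · rcases hint j with h | h
      · rw [h]
        refine Finset.sum_eq_zero fun i _ => ?_
        rw [of_apply, if_neg, zero_pow two_ne_zero]
        rintro rfl
        have := (e.symm i).2
        linarith
      · rw [h, Fintype.sum_eq_single (e ⟨j, h⟩)]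
        · simp
        · intro i hi
          rw [of_apply, if_neg, zero_pow two_ne_zero]
          rintro rfl
          exact hi (by simp)
  · push Not at hint
    obtain ⟨x, hx0, hx1⟩ := hint
    -- A single fractional entry would make the sum non-integral.
    obtain ⟨y, hyx, hy0, hy1⟩ : ∃ y, y ≠ x ∧ a y ≠ 0 ∧ a y ≠ 1 := by
      by_contra! hno
      have h2 : ∑ j ∈ Finset.univ.erase x, a j = ((Finset.univ.erase x).filter (a · = 1)).card := by
        rw [← Finset.sum_boole]
        refine Finset.sum_congr rfl fun j hj => ?_
        by_cases h : a j = 0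
        · simp [h]
        · simp [hno j (Finset.ne_of_mem_erase hj) h]
      rw [← Finset.add_sum_erase _ _ (Finset.mem_univ x), h2] at hsum
      have h3 : (0 : ℝ) < a x := (h0 x).lt_of_ne' hx0
      have h4 : a x < 1 := (h1 x).lt_of_ne hx1
      generalize ((Finset.univ.erase x).filter (a · = 1)).card = q at hsum
      have h5 : (q : ℝ) < R := by linarith
      have h6 : (R : ℝ) < q + 1 := by linarith
      norm_cast at h5 h6
      omega
    -- As much as possible is moved from `y` to `x`, so that `x` reaches 1 or `y` reaches 0. Both
    -- old values lie between the new ones, so a rotation undoes the move.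
    let b : J → ℝ := Function.update (Function.update a y (max 0 (a x + a y - 1))) x
      (min 1 (a x + a y))
    have hbx : b x = min 1 (a x + a y) := by simp [b]
    have hby : b y = max 0 (a x + a y - 1) := by simp [b, hyx]
    have hbo : ∀ j, j ≠ x → j ≠ y → b j = a j := fun j h2 h3 => by simp [b, h2, h3]
    have hx := h0 x
    have hx' := h1 x
    have hy := h0 y
    have hy' := h1 y
    have hbxy : b x + b y = a x + a y := by
      rw [hbx, hby]
      rcases le_total 1 (a x + a y) with h | h
      · rw [min_eq_left h, max_eq_right (by linarith)]; ring
      · rw [min_eq_right h, max_eq_left (by linarith)]; ring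
    have hb : ∀ j, 0 ≤ b j ∧ b j ≤ 1 := by
      intro j
      by_cases h2 : j = x
      · subst h2; rw [hbx]; exact ⟨le_min zero_le_one (by linarith), min_le_left _ _⟩
      by_cases h3 : j = y
      · subst h3; rw [hby]; exact ⟨le_max_left _ _, max_le zero_le_one (by linarith)⟩
      · rw [hbo j h2 h3]; exact ⟨h0 j, h1 j⟩
    have hbsum : ∑ j, b j = R := by
      rw [← hsum, ← sub_eq_zero, ← Finset.sum_sub_distrib, Fintype.sum_eq_add x y hyx.symm]
      · linarith
      · rintro j ⟨h2, h3⟩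
        rw [hbo j h2 h3, sub_self]
    have hlt : (Finset.univ.filter fun j => b j ≠ 0 ∧ b j ≠ 1).card < m := by
      rw [← hm]
      apply Finset.card_lt_card
      rw [Finset.ssubset_iff_of_subset]
      · rcases le_total 1 (a x + a y) with h | h
        · exact ⟨x, by simp [hx0, hx1], by simp [hbx, h]⟩
        · exact ⟨y, by simp [hy0, hy1], by simp [hby, h]⟩
      · intro j
        simp only [Finset.mem_filter, Finset.mem_univ, true_and]
        intro hj
        by_cases h2 : j = x
        · subst h2; exact ⟨hx0, hx1⟩
        by_cases h3 : j = y
        · subst h3; exact ⟨hy0, hy1⟩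
        · rwa [hbo j h2 h3] at hj
    obtain ⟨V, hV, hVb⟩ := ih _ hlt b (fun j => (hb j).1) (fun j => (hb j).2) hbsum rfl
    refine exists_rows_orthonormal_of_rotation hV hyx.symm ?_ (fun j h2 h3 => ?_) ?_
    · rw [hVb, hVb, hbxy]
    · rw [hVb, hbo j h2 h3]
    · rw [hVb, hVb, hbx, hby]
      exact ⟨max_le hx (by linarith), le_min hx' (by linarith)⟩

end

/-! ### The threshold `K₂` and the levels -/

section

variable {K : ℕ} (N : ℕ) (n : Fin K → ℕ) (p : Fin K → ℝ)

/-- The total power of the users from number `K₂` on. -/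
noncomputable def tailPower : ℝ :=
  ∑ k' ∈ Finset.univ.filter (fun i : Fin K => K₂ N n p ≤ (i : ℕ)), p k'

/-- The number of dimensions that the first `K₂` users leave to the others. -/
noncomputable def tailDim : ℝ :=
  (N : ℝ) - ∑ k' ∈ Finset.univ.filter (fun i : Fin K => (i : ℕ) < K₂ N n p), (n k' : ℝ)

/-- The power per dimension of user `k` at the optimum. -/
noncomputable def userLevel (k : Fin K) : ℝ :=
  if (k : ℕ) < K₂ N n p then p k / n k else tailPower N n p / tailDim N n p

variable {N n p}

/-- A lower set of `Fin K` consists of the indices below its cardinality. -/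
theorem mem_iff_lt_card_of_isLowerSet {A : Finset (Fin K)} (hA : IsLowerSet (A : Set (Fin K)))
    (k : Fin K) : k ∈ A ↔ (k : ℕ) < A.card := by
  refine ⟨fun hk => ?_, fun hk => ?_⟩
  · have : Finset.Iic k ⊆ A := fun i hi => hA (Finset.mem_Iic.1 hi) hk
    simpa using Finset.card_le_card this
  · by_contra hkA
    have : A ⊆ Finset.Iio k := fun i hi => by
      rw [Finset.mem_Iio]
      by_contra! hki
      exact hkA (hA hki hi)
    have := Finset.card_le_card this
    rw [Fin.card_Iio] at this
    omega

theorem isUndersized_iff (hp : ∀ k, 0 < p k) (k : Fin K) :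
    IsUndersized N n p k ↔ ((N : ℝ) - ∑ k' ∈ Finset.Iio k, (n k' : ℝ)) * p k
      < n k * ∑ k' ∈ Finset.Ici k, p k' := by
  have : 0 < ∑ k' ∈ Finset.Ici k, p k' :=
    Finset.sum_pos (fun i _ => hp i) ⟨k, Finset.mem_Ici.2 le_rfl⟩
  rw [IsUndersized, nHat, ← mul_div_assoc, div_lt_iff₀ this]

/-- Being undersized means that the remaining dimensions, each filled with power `p k / n k`, would
need more room than the remaining power forbids: their product is less than that power. The users
between `k` and `l` have ratios at most `p k / n k`, so removing them keeps the inequality; lowering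
the ratio to `p l / n l` keeps it too, unless the dimensions are used up, and then it is trivial. -/
theorem IsUndersized.mono (hn : ∀ k, 0 < n k) (hp : ∀ k, 0 < p k)
    (hord : Antitone fun k => p k / (n k : ℝ)) {k l : Fin K} (hkl : k ≤ l)
    (hk : IsUndersized N n p k) : IsUndersized N n p l := by
  have hn' : ∀ k, (0 : ℝ) < n k := fun k => by exact_mod_cast hn k
  rw [isUndersized_iff hp] at hk ⊢
  have hQ : 0 < ∑ k' ∈ Finset.Ici l, p k' :=
    Finset.sum_pos (fun i _ => hp i) ⟨l, Finset.mem_Ici.2 le_rfl⟩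
  have h1 : ∑ k' ∈ Finset.Iio l, (n k' : ℝ)
      = ∑ k' ∈ Finset.Iio k, (n k' : ℝ) + ∑ k' ∈ Finset.Ico k l, (n k' : ℝ) := by
    rw [← Finset.sum_union]
    · congr 1; ext i; simp only [Finset.mem_Iio, Finset.mem_union, Finset.mem_Ico]; grind
    · rw [Finset.disjoint_left]; intro i; simp only [Finset.mem_Iio, Finset.mem_Ico]; grind
  have h2 : ∑ k' ∈ Finset.Ici k, p k'
      = ∑ k' ∈ Finset.Ico k l, p k' + ∑ k' ∈ Finset.Ici l, p k' := by
    rw [← Finset.sum_union]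
    · congr 1; ext i; simp only [Finset.mem_Ici, Finset.mem_union, Finset.mem_Ico]; grind
    · rw [Finset.disjoint_left]; intro i; simp only [Finset.mem_Ici, Finset.mem_Ico]; grind
  rw [h2] at hk
  rw [h1]
  have h3 : ∑ k' ∈ Finset.Ico k l, p k' ≤ (∑ k' ∈ Finset.Ico k l, (n k' : ℝ)) * (p k / n k) := by
    rw [Finset.sum_mul]
    refine Finset.sum_le_sum fun i hi => ?_
    have := hord (Finset.mem_Ico.1 hi).1
    simp only at this
    rwa [div_le_iff₀ (hn' i), mul_comm] at this
  have h4 : p l / n l ≤ p k / n k := hord hkl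
  have h5 : 0 < p k / n k := div_pos (hp k) (hn' k)
  have hk' : ((N : ℝ) - ∑ k' ∈ Finset.Iio k, (n k' : ℝ)) * (p k / n k)
      < ∑ k' ∈ Finset.Ico k l, p k' + ∑ k' ∈ Finset.Ici l, p k' := by
    rw [← mul_div_assoc, div_lt_iff₀ (hn' k)]
    linarith
  generalize ∑ k' ∈ Finset.Iio k, (n k' : ℝ) = A at *
  generalize ∑ k' ∈ Finset.Ico k l, (n k' : ℝ) = B at *
  rcases le_total ((N : ℝ) - (A + B)) 0 with h | h
  · calc ((N : ℝ) - (A + B)) * p l ≤ 0 := mul_nonpos_of_nonpos_of_nonneg h (hp l).le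
      _ < _ := mul_pos (hn' l) hQ
  · have h6 := mul_le_mul_of_nonneg_left h4 h
    have h7 : ((N : ℝ) - (A + B)) * (p l / n l) < ∑ k' ∈ Finset.Ici l, p k' := by linarith
    rw [← mul_div_assoc, div_lt_iff₀ (hn' l)] at h7
    linarith

/-- By monotonicity these users form an initial segment, so counting them locates the threshold. -/
theorem not_isUndersized_iff (hn : ∀ k, 0 < n k) (hp : ∀ k, 0 < p k)
    (hord : Antitone fun k => p k / (n k : ℝ)) (k : Fin K) :
    ¬ IsUndersized N n p k ↔ (k : ℕ) < K₂ N n p := by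
  classical
  have hlow : IsLowerSet ((Finset.univ.filter fun k => ¬ IsUndersized N n p k : Finset (Fin K)) :
      Set (Fin K)) := by
    intro a b hba ha
    simp only [Finset.coe_filter, Finset.mem_univ, true_and, Set.mem_ofPred_eq] at ha ⊢
    exact fun hb => ha (hb.mono hn hp hord hba)
  have := mem_iff_lt_card_of_isLowerSet hlow k
  rw [Finset.mem_filter, ← Fintype.card_subtype, ← Nat.card_eq_fintype_card] at this
  simpa [K₂] using this

/-- The inequalities that characterize the threshold `K₂`. -/
theorem tailDim_tailPower_bounds (hN : 0 < N) (hn : ∀ k, 0 < n k) (hp : ∀ k, 0 < p k)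
    (hord : Antitone fun k => p k / (n k : ℝ)) :
    0 ≤ tailDim N n p ∧ 0 ≤ tailPower N n p ∧ (tailDim N n p = 0 → tailPower N n p = 0) ∧
      ∀ k : Fin K, (k : ℕ) < K₂ N n p → tailPower N n p ≤ tailDim N n p * (p k / n k) := by
  have hn' : ∀ k, (0 : ℝ) < n k := fun k => by exact_mod_cast hn k
  have hQ : 0 ≤ tailPower N n p := Finset.sum_nonneg fun i _ => (hp i).le
  rcases Nat.eq_zero_or_pos (K₂ N n p) with h0 | hpos
  · have : tailDim N n p = N := by simp [tailDim, h0]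
    rw [this, h0]
    exact ⟨by positivity, hQ, fun h => absurd h (by positivity), fun k hk => absurd hk (by simp)⟩
  have hK : K₂ N n p ≤ K := by
    have := Finite.card_subtype_le (fun k : Fin K => ¬ IsUndersized N n p k)
    simpa [K₂] using this
  -- The last user that is not undersized has the smallest ratio among the saturated ones, so its
  -- inequality implies theirs.
  let m : Fin K := ⟨K₂ N n p - 1, by omega⟩
  have hm : ¬ IsUndersized N n p m := (not_isUndersized_iff hn hp hord m).2 (by simp [m]; omega)
  rw [isUndersized_iff hp, not_lt] at hm
  have h1 : tailDim N n p = (N : ℝ) - ∑ k' ∈ Finset.Iio m, (n k' : ℝ) - n m := by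
    have : Finset.univ.filter (fun i : Fin K => (i : ℕ) < K₂ N n p) = insert m (Finset.Iio m) := by
      ext i
      simp only [Finset.mem_filter, Finset.mem_univ, true_and, Finset.mem_insert, Finset.mem_Iio,
        Fin.ext_iff, Fin.lt_def, m]
      omega
    rw [tailDim, this, Finset.sum_insert (by simp)]
    ring
  have h2 : ∑ k' ∈ Finset.Ici m, p k' = p m + tailPower N n p := by
    have : Finset.Ici m = insert m (Finset.univ.filter fun i : Fin K => K₂ N n p ≤ (i : ℕ)) := by
      ext i
      simp only [Finset.mem_filter, Finset.mem_univ, true_and, Finset.mem_insert, Finset.mem_Ici,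
        Fin.ext_iff, Fin.le_def, m]
      omega
    rw [this, Finset.sum_insert (by simp [m]; omega), tailPower]
  have h3 : tailPower N n p ≤ tailDim N n p * (p m / n m) := by
    rw [← mul_div_assoc, le_div_iff₀ (hn' m), h1]
    rw [h2] at hm
    linarith
  have h5 : 0 < p m / n m := div_pos (hp m) (hn' m)
  have hR : 0 ≤ tailDim N n p := nonneg_of_mul_nonneg_left (hQ.trans h3) h5
  refine ⟨hR, hQ, fun h => le_antisymm (by simpa [h] using h3) hQ, fun k hk => h3.trans ?_⟩
  have : k ≤ m := by simp only [Fin.le_def, m]; omega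
  exact mul_le_mul_of_nonneg_left (hord this) hR

theorem div_le_level_of_le (hN : 0 < N) (hn : ∀ k, 0 < n k) (hp : ∀ k, 0 < p k)
    (hord : Antitone fun k => p k / (n k : ℝ)) {k : Fin K} (hk : K₂ N n p ≤ k) :
    0 < tailDim N n p ∧ 0 < tailPower N n p ∧ p k / n k ≤ tailPower N n p / tailDim N n p := by
  have hn' : ∀ k, (0 : ℝ) < n k := fun k => by exact_mod_cast hn k
  obtain ⟨hR, -, hRQ, -⟩ := tailDim_tailPower_bounds hN hn hp hord
  have hQ : 0 < tailPower N n p :=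
    Finset.sum_pos (fun i _ => hp i) ⟨k, by simpa using hk⟩
  have hR : 0 < tailDim N n p := hR.lt_of_ne' fun h => hQ.ne' (hRQ h)
  refine ⟨hR, hQ, ?_⟩
  -- The first undersized user has the largest ratio in the tail.
  let m : Fin K := ⟨K₂ N n p, hk.trans_lt k.2⟩
  have hm : IsUndersized N n p m := by
    by_contra h
    exact lt_irrefl _ ((not_isUndersized_iff hn hp hord m).1 h)
  rw [isUndersized_iff hp] at hm
  have h1 : (N : ℝ) - ∑ k' ∈ Finset.Iio m, (n k' : ℝ) = tailDim N n p := by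
    rw [tailDim]; congr 2; ext i; simp [m, Fin.lt_def]
  have h2 : ∑ k' ∈ Finset.Ici m, p k' = tailPower N n p := by
    rw [tailPower]; congr 1; ext i; simp [m, Fin.le_def]
  rw [h1, h2] at hm
  refine (hord (show m ≤ k from hk)).trans ?_
  rw [div_le_div_iff₀ (hn' m) hR]
  linarith

theorem level_le_div_of_lt (hN : 0 < N) (hn : ∀ k, 0 < n k) (hp : ∀ k, 0 < p k)
    (hord : Antitone fun k => p k / (n k : ℝ)) {k : Fin K} (hk : (k : ℕ) < K₂ N n p) :
    tailPower N n p / tailDim N n p ≤ p k / n k := by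
  obtain ⟨hR, hQ, -, h⟩ := tailDim_tailPower_bounds hN hn hp hord
  refine div_le_of_le_mul₀ hR (div_pos (hp k) (by exact_mod_cast hn k)).le ?_
  rw [mul_comm]
  exact h k hk

theorem level_nonneg (hN : 0 < N) (hn : ∀ k, 0 < n k) (hp : ∀ k, 0 < p k)
    (hord : Antitone fun k => p k / (n k : ℝ)) : 0 ≤ tailPower N n p / tailDim N n p := by
  obtain ⟨hR, hQ, -, -⟩ := tailDim_tailPower_bounds hN hn hp hord
  exact div_nonneg hQ hR

/-- If no dimension is left, no power is left either, so the convention `0 / 0 = 0` is harmless. -/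
theorem tailDim_mul_level (hN : 0 < N) (hn : ∀ k, 0 < n k) (hp : ∀ k, 0 < p k)
    (hord : Antitone fun k => p k / (n k : ℝ)) :
    tailDim N n p * (tailPower N n p / tailDim N n p) = tailPower N n p := by
  obtain ⟨-, -, h, -⟩ := tailDim_tailPower_bounds hN hn hp hord
  by_cases h0 : tailDim N n p = 0
  · rw [h h0, h0]; simp
  · field_simp

theorem userLevel_pos (hN : 0 < N) (hn : ∀ k, 0 < n k) (hp : ∀ k, 0 < p k)
    (hord : Antitone fun k => p k / (n k : ℝ)) (k : Fin K) : 0 < userLevel N n p k := by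
  rw [userLevel]
  split_ifs with hk
  · exact div_pos (hp k) (by exact_mod_cast hn k)
  · obtain ⟨h1, h2, -⟩ := div_le_level_of_le hN hn hp hord (not_lt.1 hk)
    exact div_pos h2 h1

theorem div_le_userLevel (hN : 0 < N) (hn : ∀ k, 0 < n k) (hp : ∀ k, 0 < p k)
    (hord : Antitone fun k => p k / (n k : ℝ)) (k : Fin K) : p k / n k ≤ userLevel N n p k := by
  rw [userLevel]
  split_ifs with hk
  · exact le_rfl
  · exact (div_le_level_of_le hN hn hp hord (not_lt.1 hk)).2.2

theorem level_le_userLevel (hN : 0 < N) (hn : ∀ k, 0 < n k) (hp : ∀ k, 0 < p k)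
    (hord : Antitone fun k => p k / (n k : ℝ)) (k : Fin K) :
    tailPower N n p / tailDim N n p ≤ userLevel N n p k := by
  rw [userLevel]
  split_ifs with hk
  · exact level_le_div_of_lt hN hn hp hord hk
  · exact le_rfl

/-- This formula covers both cases at once and translates between bandwidths and levels. -/
theorem wStar_eq (hN : 0 < N) (hn : ∀ k, 0 < n k) (hp : ∀ k, 0 < p k)
    (hord : Antitone fun k => p k / (n k : ℝ)) (k : Fin K) :
    wStar N n p k = p k / (2 * N * userLevel N n p k) := by
  have hN' : (N : ℝ) ≠ 0 := by positivity
  have hpk := (hp k).ne'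
  rw [wStar, userLevel]
  split_ifs with hk
  · have : (n k : ℝ) ≠ 0 := by exact_mod_cast (hn k).ne'
    field_simp
  · obtain ⟨h1, h2, -⟩ := div_le_level_of_le hN hn hp hord (not_lt.1 hk)
    rw [← tailDim, ← tailPower]
    field_simp

theorem sum_split_tail (f : Fin K → ℝ) :
    ∑ k, f k = ∑ k ∈ Finset.univ.filter (fun i : Fin K => (i : ℕ) < K₂ N n p), f k
      + ∑ k ∈ Finset.univ.filter (fun i : Fin K => K₂ N n p ≤ (i : ℕ)), f k := by
  rw [← Finset.sum_filter_add_sum_filter_not Finset.univ (fun i : Fin K => (i : ℕ) < K₂ N n p)]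
  simp only [not_lt]

/-- The bandwidth `1 / 2` is used up unless the level of the tail vanishes. -/
theorem sum_wStar (hN : 0 < N) (hn : ∀ k, 0 < n k) (hp : ∀ k, 0 < p k)
    (hord : Antitone fun k => p k / (n k : ℝ)) :
    ∑ k, wStar N n p k ≤ 1 / 2 ∧
      (∑ k, wStar N n p k = 1 / 2 ∨ tailPower N n p / tailDim N n p = 0) := by
  have hN' : (N : ℝ) ≠ 0 := by positivity
  have h1 : ∑ k ∈ Finset.univ.filter (fun i : Fin K => (i : ℕ) < K₂ N n p), wStar N n p k
      = (N - tailDim N n p) / (2 * N) := by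
    rw [tailDim, sub_sub_cancel, Finset.sum_div]
    refine Finset.sum_congr rfl fun k hk => ?_
    rw [wStar, if_pos (by simpa using hk)]
  -- The last factor is 1, or `0 / 0 = 0` when the tail is empty.
  have h2 : ∑ k ∈ Finset.univ.filter (fun i : Fin K => K₂ N n p ≤ (i : ℕ)), wStar N n p k
      = 1 / (2 * N) * tailDim N n p * (tailPower N n p / tailPower N n p) := by
    conv_rhs => enter [2, 1]; rw [tailPower]
    rw [Finset.sum_div, Finset.mul_sum]
    refine Finset.sum_congr rfl fun k hk => ?_
    rw [wStar, if_neg (by simpa using hk), ← tailDim, ← tailPower]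
  rw [sum_split_tail (N := N) (n := n) (p := p), h1, h2]
  obtain ⟨hR, -, -, -⟩ := tailDim_tailPower_bounds hN hn hp hord
  by_cases hQ : tailPower N n p = 0
  · rw [hQ]
    refine ⟨?_, Or.inr (by simp)⟩
    have : 0 < (N : ℝ) := by positivity
    rw [div_zero, mul_zero, add_zero, div_le_iff₀ (by positivity)]
    linarith
  · have : (N - tailDim N n p) / (2 * N)
      + 1 / (2 * N) * tailDim N n p * (tailPower N n p / tailPower N n p) = 1 / 2 := by
      field_simp
      ring
    exact ⟨this.le, Or.inl this⟩

theorem wStar_le (hN : 0 < N) (hn : ∀ k, 0 < n k) (hp : ∀ k, 0 < p k)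
    (hord : Antitone fun k => p k / (n k : ℝ)) (k : Fin K) :
    wStar N n p k ≤ n k / (2 * N) := by
  have hN' : (0 : ℝ) < N := by positivity
  have hn' : (0 : ℝ) < n k := by exact_mod_cast hn k
  have h := div_le_userLevel hN hn hp hord k
  have h' := userLevel_pos hN hn hp hord k
  rw [wStar_eq hN hn hp hord, div_le_div_iff₀ (by positivity) (by positivity)]
  rw [div_le_iff₀ hn'] at h
  nlinarith

theorem wStar_pos (hN : 0 < N) (hn : ∀ k, 0 < n k) (hp : ∀ k, 0 < p k)
    (hord : Antitone fun k => p k / (n k : ℝ)) (k : Fin K) : 0 < wStar N n p k := by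
  rw [wStar_eq hN hn hp hord]
  have := userLevel_pos hN hn hp hord k
  have := hp k
  positivity

end

/-! ### The optimal bandwidth profiles -/

section

/-- The tangent of the strictly concave function `x ↦ x log (1 + a / x)` at `x₀`. -/
theorem mul_log_one_add_div_le {a x x₀ : ℝ} (ha : 0 < a) (hx : 0 ≤ x) (hx₀ : 0 < x₀) :
    x * Real.log (1 + a / x) ≤ x * Real.log (1 + a / x₀) + a * (x₀ - x) / (x₀ + a) ∧
      (x * Real.log (1 + a / x) = x * Real.log (1 + a / x₀) + a * (x₀ - x) / (x₀ + a) →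
        x = x₀) := by
  rcases hx.eq_or_lt with rfl | hx
  · have : 0 < a * x₀ / (x₀ + a) := by positivity
    simp only [zero_mul, zero_add, sub_zero]
    exact ⟨this.le, fun h => absurd h this.ne⟩
  have hy : 0 < (1 + a / x) / (1 + a / x₀) := by positivity
  have hlog : x * Real.log (1 + a / x) - x * Real.log (1 + a / x₀)
      = x * Real.log ((1 + a / x) / (1 + a / x₀)) := by
    rw [Real.log_div (by positivity) (by positivity)]; ring
  -- With `y` the ratio of the two arguments, the tangent inequality is `x` times `log y ≤ y - 1`.
  have hlin : x * ((1 + a / x) / (1 + a / x₀) - 1) = a * (x₀ - x) / (x₀ + a) := by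
    field_simp
    ring
  refine ⟨?_, fun h => ?_⟩
  · have := mul_le_mul_of_nonneg_left (Real.log_le_sub_one_of_pos hy) hx.le
    linarith
  · by_contra hne
    have hy1 : (1 + a / x) / (1 + a / x₀) ≠ 1 := by
      intro h1
      rw [h1, sub_self, mul_zero, eq_comm, div_eq_zero_iff, mul_eq_zero] at hlin
      rcases hlin with (h | h) | h
      · exact ha.ne' h
      · exact hne (by linarith)
      · linarith
    have := mul_lt_mul_of_pos_left (Real.log_lt_sub_one_of_pos hy hy1) hx
    linarith

/-- At `z = a / x` this function is the derivative of `x log (1 + a / x)` in `x`: the marginal value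
of bandwidth grows with the level. -/
theorem log_one_add_sub_monotoneOn :
    MonotoneOn (fun z : ℝ => Real.log (1 + z) - z / (1 + z)) (Set.Ici 0) := by
  intro y hy z hz hyz
  have hy : 0 ≤ y := hy
  have hz : 0 ≤ z := hz
  have h1 := Real.one_sub_inv_le_log_of_pos (x := (1 + z) / (1 + y)) (by positivity)
  rw [Real.log_div (by positivity) (by positivity)] at h1
  have h2 : z / (1 + z) - y / (1 + y) ≤ 1 - ((1 + z) / (1 + y))⁻¹ := by
    have h3 : 1 - ((1 + z) / (1 + y))⁻¹ - (z / (1 + z) - y / (1 + y))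
        = (z - y) * y / ((1 + z) * (1 + y)) := by
      field_simp
      ring
    have : 0 ≤ (z - y) * y / ((1 + z) * (1 + y)) := by
      have := sub_nonneg.2 hyz
      positivity
    linarith
  simp only
  linarith

variable {K : ℕ} {N : ℕ} {n : Fin K → ℕ} {p : Fin K → ℝ} {σ : ℝ}

theorem bandwidthRate_eq (w : (k : Fin K) → Fin (n k) → ℝ) :
    bandwidthRate n p σ w
      = (∑ k, (∑ l, w k l) * Real.log (1 + p k / (2 * σ ^ 2) / ∑ l, w k l)) / Real.log 2 := by
  rw [bandwidthRate, Finset.sum_div]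
  refine Finset.sum_congr rfl fun k _ => ?_
  rw [← Finset.sum_mul, Real.logb, div_div, mul_div_assoc]

theorem sum_le_of_box {w : (k : Fin K) → Fin (n k) → ℝ}
    (hw : ∀ k l, 0 ≤ w k l ∧ w k l ≤ 1 / (2 * (N : ℝ))) (k : Fin K) :
    0 ≤ ∑ l, w k l ∧ ∑ l, w k l ≤ n k / (2 * N) := by
  refine ⟨Finset.sum_nonneg fun l _ => (hw k l).1, ?_⟩
  have := Finset.sum_le_sum fun l (_ : l ∈ Finset.univ) => (hw k l).2
  simpa [div_eq_mul_inv] using this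

/-- Lagrangian argument with the multiplier `ψ (c * τ)`. Each user's rate lies below its tangent at
`wStar`. A saturated user has a slope at least the multiplier but cannot exceed `wStar`, so the
multiplier may replace every slope. Equality forces tangency, hence the totals. -/
theorem bandwidthRate_le (hN : 0 < N) (hn : ∀ k, 0 < n k) (hp : ∀ k, 0 < p k) (hσ : 0 < σ)
    (hord : Antitone fun k => p k / (n k : ℝ)) {w : (k : Fin K) → Fin (n k) → ℝ}
    (hw : FeasibleBandwidth N n w) :
    ∑ k, (∑ l, w k l) * Real.log (1 + p k / (2 * σ ^ 2) / ∑ l, w k l)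
        ≤ ∑ k, wStar N n p k * Real.log (1 + p k / (2 * σ ^ 2) / wStar N n p k) ∧
      (∑ k, (∑ l, w k l) * Real.log (1 + p k / (2 * σ ^ 2) / ∑ l, w k l)
        = ∑ k, wStar N n p k * Real.log (1 + p k / (2 * σ ^ 2) / wStar N n p k) →
        ∀ k, ∑ l, w k l = wStar N n p k) := by
  have hN' : (0 : ℝ) < N := by positivity
  set W : Fin K → ℝ := fun k => ∑ l, w k l with hW
  set X := wStar N n p with hX
  have hXpos : ∀ k, 0 < X k := wStar_pos hN hn hp hord
  have ha : ∀ k, 0 < p k / (2 * σ ^ 2) := fun k => by have := hp k; positivity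
  set c := N / σ ^ 2 with hc
  have hcpos : 0 < c := by positivity
  set ψ : ℝ → ℝ := fun z => Real.log (1 + z) - z / (1 + z) with hψ
  set τ := tailPower N n p / tailDim N n p with hτ
  have hτ0 : 0 ≤ τ := level_nonneg hN hn hp hord
  have hratio : ∀ k, p k / (2 * σ ^ 2) / X k = c * userLevel N n p k := fun k => by
    have h1 := userLevel_pos hN hn hp hord k
    have h2 := hp k
    rw [hX, wStar_eq hN hn hp hord, hc]
    field_simp
  have hφ := fun k => mul_log_one_add_div_le (ha k) (sum_le_of_box hw.1 k).1 (hXpos k)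
  have hsplit : ∀ k, W k * Real.log (1 + p k / (2 * σ ^ 2) / X k)
      + p k / (2 * σ ^ 2) * (X k - W k) / (X k + p k / (2 * σ ^ 2))
      = X k * Real.log (1 + p k / (2 * σ ^ 2) / X k)
        + ψ (c * userLevel N n p k) * (W k - X k) := fun k => by
    have h1 := hXpos k
    have h2 := ha k
    rw [← hratio, hψ]
    simp only
    generalize p k / (2 * σ ^ 2) = b at *
    have h3 : b / X k / (1 + b / X k) = b / (X k + b) := by field_simp
    rw [h3]
    ring
  have hslope : ∀ k, ψ (c * userLevel N n p k) * (W k - X k) ≤ ψ (c * τ) * (W k - X k) := by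
    intro k
    by_cases hk : (k : ℕ) < K₂ N n p
    · refine mul_le_mul_of_nonpos_right (log_one_add_sub_monotoneOn ?_ ?_ ?_) ?_
      · exact mul_nonneg hcpos.le hτ0
      · exact mul_nonneg hcpos.le (userLevel_pos hN hn hp hord k).le
      · exact mul_le_mul_of_nonneg_left (level_le_userLevel hN hn hp hord k) hcpos.le
      · have := (sum_le_of_box hw.1 k).2
        rw [hX, wStar, if_pos hk]
        linarith
    · rw [userLevel, if_neg hk]
  have hψτ : 0 ≤ ψ (c * τ) := by
    have := log_one_add_sub_monotoneOn (Set.mem_Ici.2 le_rfl)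
      (Set.mem_Ici.2 (mul_nonneg hcpos.le hτ0)) (mul_nonneg hcpos.le hτ0)
    simpa [hψ] using this
  -- Complementary slackness: `X` exhausts the bandwidth, or τ and with it the multiplier vanish.
  have htot : ∑ k, ψ (c * τ) * (W k - X k) ≤ 0 := by
    rw [← Finset.mul_sum, Finset.sum_sub_distrib]
    rcases (sum_wStar hN hn hp hord).2 with h | h
    · refine mul_nonpos_of_nonneg_of_nonpos hψτ ?_
      have := hw.2
      rw [hX, h]
      linarith
    · rw [hτ, h]
      simp [hψ]
  have hsumle := Finset.sum_le_sum fun k (_ : k ∈ Finset.univ) => (hφ k).1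
  have hright : ∑ k, (W k * Real.log (1 + p k / (2 * σ ^ 2) / X k)
      + p k / (2 * σ ^ 2) * (X k - W k) / (X k + p k / (2 * σ ^ 2)))
      ≤ ∑ k, X k * Real.log (1 + p k / (2 * σ ^ 2) / X k) := by
    rw [Finset.sum_congr rfl fun k _ => hsplit k, Finset.sum_add_distrib]
    have := Finset.sum_le_sum fun k (_ : k ∈ Finset.univ) => hslope k
    linarith
  refine ⟨hsumle.trans hright, fun heq k => ?_⟩
  have := (Finset.sum_eq_sum_iff_of_le fun k (_ : k ∈ Finset.univ) => (hφ k).1).1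
    (le_antisymm hsumle (hright.trans heq.ge)) k (Finset.mem_univ k)
  exact (hφ k).2 this

/-- The optimal bandwidth profiles. -/
theorem isOptimalBandwidth_iff (hN : 0 < N) (hn : ∀ k, 0 < n k) (hp : ∀ k, 0 < p k) (hσ : 0 < σ)
    (hord : Antitone fun k => p k / (n k : ℝ)) (w : (k : Fin K) → Fin (n k) → ℝ) :
    IsOptimalBandwidth N n p σ w ↔
      (∀ k l, 0 ≤ w k l ∧ w k l ≤ 1 / (2 * (N : ℝ))) ∧ ∀ k, ∑ l, w k l = wStar N n p k := by
  have hN' : (0 : ℝ) < N := by positivity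
  have hlog : 0 < Real.log 2 := Real.log_pos one_lt_two
  have hfeas : ∀ {w : (k : Fin K) → Fin (n k) → ℝ},
      (∀ k l, 0 ≤ w k l ∧ w k l ≤ 1 / (2 * (N : ℝ))) → (∀ k, ∑ l, w k l = wStar N n p k) →
      FeasibleBandwidth N n w := fun hbox hs =>
    ⟨hbox, by simp only [hs]; exact (sum_wStar hN hn hp hord).1⟩
  constructor
  · rintro ⟨hw, hmax⟩
    refine ⟨hw.1, (bandwidthRate_le hN hn hp hσ hord hw).2
      (le_antisymm (bandwidthRate_le hN hn hp hσ hord hw).1 ?_)⟩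
    -- The even split is a feasible competitor that attains the bound.
    let v : (k : Fin K) → Fin (n k) → ℝ := fun k _ => wStar N n p k / n k
    have hv : ∀ k, ∑ l, v k l = wStar N n p k := fun k => by
      have : (n k : ℝ) ≠ 0 := by exact_mod_cast (hn k).ne'
      simp only [v, Finset.sum_const, Finset.card_univ, Fintype.card_fin, nsmul_eq_mul]
      field_simp
    have hvf : FeasibleBandwidth N n v := hfeas (fun k l => by
      have h1 := (wStar_pos hN hn hp hord k).le
      have h2 := wStar_le hN hn hp hord k
      have h3 : (0 : ℝ) < n k := by exact_mod_cast hn k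
      refine ⟨by positivity, ?_⟩
      rw [div_le_iff₀ h3]
      exact h2.trans_eq (by ring)) hv
    have := hmax v hvf
    rw [bandwidthRate_eq, bandwidthRate_eq, div_le_div_iff_of_pos_right hlog] at this
    simpa only [hv] using this
  · rintro ⟨hbox, hs⟩
    refine ⟨hfeas hbox hs, fun w' hw' => ?_⟩
    rw [bandwidthRate_eq, bandwidthRate_eq, div_le_div_iff_of_pos_right hlog]
    simp only [hs]
    exact (bandwidthRate_le hN hn hp hσ hord hw').1

end

/-! ### The optimal power distributions -/

section

open Matrix

variable {K : ℕ} {N : ℕ} {n : Fin K → ℕ} {p : Fin K → ℝ} {σ : ℝ}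

/-- The dimensions of the signal space at the optimum: one for every stream of the first `K₂` users
and `R` further ones, shared by the other users. -/
abbrev DimIndex (N : ℕ) (n : Fin K → ℕ) (p : Fin K → ℝ) (R : ℕ) : Type :=
  {j : StreamIndex n // (j.1 : ℕ) < K₂ N n p} ⊕ Fin R

/-- The received power in each dimension at the optimum. -/
noncomputable def dimLevel (N : ℕ) (n : Fin K → ℕ) (p : Fin K → ℝ) (R : ℕ) : DimIndex N n p R → ℝ :=
  Sum.elim (fun j => userLevel N n p j.1.1) fun _ => tailPower N n p / tailDim N n p

theorem sum_dimLevel (R : ℕ) (φ : ℝ → ℝ) :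
    ∑ i, φ (dimLevel N n p R i)
      = ∑ k ∈ Finset.univ.filter (fun i : Fin K => (i : ℕ) < K₂ N n p), n k * φ (userLevel N n p k)
        + R * φ (tailPower N n p / tailDim N n p) := by
  rw [Fintype.sum_sum_type]
  congr 1
  · simp only [dimLevel, Sum.elim_inl]
    rw [← Finset.sum_subtype (Finset.univ.filter fun j : StreamIndex n => (j.1 : ℕ) < K₂ N n p)
      (by simp) (fun j => φ (userLevel N n p j.1)), Finset.sum_filter, Fintype.sum_sigma,
      Finset.sum_filter]
    refine Finset.sum_congr rfl fun k _ => ?_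
    simp
  · simp [dimLevel]

theorem card_dimIndex {R : ℕ} (hR : (R : ℝ) = tailDim N n p) :
    Fintype.card (DimIndex N n p R) = N := by
  have h := sum_dimLevel (N := N) (n := n) (p := p) R fun _ => 1
  simp only [Finset.sum_const, Finset.card_univ, nsmul_eq_mul, mul_one, hR, tailDim] at h
  rw [add_sub_cancel] at h
  exact_mod_cast h

theorem exists_nat_eq_tailDim (hN : 0 < N) (hn : ∀ k, 0 < n k) (hp : ∀ k, 0 < p k)
    (hord : Antitone fun k => p k / (n k : ℝ)) : ∃ R : ℕ, (R : ℝ) = tailDim N n p := by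
  have h := (tailDim_tailPower_bounds hN hn hp hord).1
  rw [tailDim] at h ⊢
  refine ⟨N - ∑ k' ∈ Finset.univ.filter (fun i : Fin K => (i : ℕ) < K₂ N n p), n k', ?_⟩
  rw [Nat.cast_sub (by exact_mod_cast sub_nonneg.1 h)]
  push_cast
  rfl

theorem dimLevel_nonneg (hN : 0 < N) (hn : ∀ k, 0 < n k) (hp : ∀ k, 0 < p k)
    (hord : Antitone fun k => p k / (n k : ℝ)) {R : ℕ} (i : DimIndex N n p R) :
    0 ≤ dimLevel N n p R i := by
  rcases i with j | r
  · exact (userLevel_pos hN hn hp hord _).le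
  · exact level_nonneg hN hn hp hord

/-- The determinant in the sum rate is at most the one for the optimal levels, and equality bounds
the powers of the streams. -/
theorem det_le_prod_dimLevel (hN : 0 < N) (hn : ∀ k, 0 < n k) (hp : ∀ k, 0 < p k) (hσ : 0 < σ)
    (hord : Antitone fun k => p k / (n k : ℝ)) {R : ℕ} (hR : (R : ℝ) = tailDim N n p)
    {P : (k : Fin K) → Fin (n k) → ℝ} (hP : FeasiblePower n p P)
    {S : Matrix (Fin N) (StreamIndex n) ℝ} (hS : FeasibleSignatures N n S) :
    (1 + (1 / σ ^ 2) • (S * diagonal (fun j : StreamIndex n => P j.1 j.2) * Sᵀ)).det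
        ≤ ∏ i, (1 + 1 / σ ^ 2 * N * dimLevel N n p R i) ∧
      ((1 + (1 / σ ^ 2) • (S * diagonal (fun j : StreamIndex n => P j.1 j.2) * Sᵀ)).det
        = ∏ i, (1 + 1 / σ ^ 2 * N * dimLevel N n p R i) → ∀ k l, P k l ≤ userLevel N n p k) := by
  have hN' : (0 : ℝ) < N := by positivity
  have hcard := card_dimIndex hR
  -- Each saturated stream labels one dimension. The tail streams need no triangularity, since their
  -- level τ is the lowest, so zero vectors fill the other `R` places.
  obtain ⟨e, he⟩ := exists_orthonormalBasis_triangular (E := EuclideanSpace ℝ (Fin N))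
    (by simp [hcard]) (dimLevel N n p R)
    (Sum.elim (fun j => WithLp.toLp 2 fun r => S r j.1) fun _ => 0)
  let U : Matrix (DimIndex N n p R) (Fin N) ℝ := of fun i r => e i r
  have hU : U * Uᵀ = 1 := by
    ext i i'
    have := orthonormal_iff_ite.1 e.orthonormal i' i
    rw [PiLp.inner_apply] at this
    simpa [U, mul_apply, one_apply, eq_comm] using this
  have hU' : Uᵀ * U = 1 := (mul_eq_one_comm_of_card_eq _ _ _ (by simp [hcard])).1 hU
  have hdet : (1 + (1 / σ ^ 2) •
        (U * S * diagonal (fun j : StreamIndex n => P j.1 j.2) * (U * S)ᵀ)).det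
      = (1 + (1 / σ ^ 2) • (S * diagonal (fun j : StreamIndex n => P j.1 j.2) * Sᵀ)).det := by
    rw [transpose_mul, show U * S * diagonal (fun j : StreamIndex n => P j.1 j.2) * (Sᵀ * Uᵀ)
      = U * (S * diagonal (fun j : StreamIndex n => P j.1 j.2) * Sᵀ * Uᵀ) by
        simp only [Matrix.mul_assoc], ← Matrix.mul_smul, det_one_add_mul_comm, Matrix.smul_mul,
      Matrix.mul_assoc _ Uᵀ, hU', Matrix.mul_one]
  have hcol : ∀ j, ∑ i, (U * S) i j ^ 2 = N := by
    intro j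
    have h1 : ((U * S)ᵀ * (U * S)) j j = (Sᵀ * S) j j := by
      rw [transpose_mul, Matrix.mul_assoc, ← Matrix.mul_assoc Uᵀ, hU', Matrix.one_mul]
    rw [mul_apply, mul_apply] at h1
    simp only [transpose_apply, ← sq] at h1
    rw [h1, hS j]
  have htri : ∀ i (j : StreamIndex n), (U * S) i j ≠ 0 →
      userLevel N n p j.1 ≤ dimLevel N n p R i := by
    intro i j hij
    by_cases hj : (j.1 : ℕ) < K₂ N n p
    · by_contra! hlt
      refine hij ?_
      have := he i (Sum.inl ⟨j, hj⟩) hlt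
      rw [PiLp.inner_apply] at this
      simpa [U, mul_apply, mul_comm] using this
    · rw [userLevel, if_neg hj]
      rcases i with j' | r
      · exact level_le_userLevel hN hn hp hord _
      · exact le_rfl
  -- At each level, streams and dimensions carry the same total power: `p k` for a saturated user,
  -- `R` times τ for the tail.
  have hbal : ∑ j : StreamIndex n, P j.1 j.2 / (1 + 1 / σ ^ 2 * N * userLevel N n p j.1)
      = ∑ i, dimLevel N n p R i / (1 + 1 / σ ^ 2 * N * dimLevel N n p R i) := by
    rw [sum_dimLevel R fun x => x / (1 + 1 / σ ^ 2 * N * x), Fintype.sum_sigma,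
      sum_split_tail (N := N) (n := n) (p := p)]
    simp only [← Finset.sum_div, hP.2]
    congr 1
    · refine Finset.sum_congr rfl fun k hk => ?_
      rw [← mul_div_assoc]
      congr 1
      rw [userLevel, if_pos (by simpa using hk)]
      have : (n k : ℝ) ≠ 0 := by exact_mod_cast (hn k).ne'
      field_simp
    · rw [← mul_div_assoc, hR, tailDim_mul_level hN hn hp hord]
      conv_rhs => enter [1]; rw [tailPower]
      rw [Finset.sum_div]
      refine Finset.sum_congr rfl fun k hk => ?_
      rw [userLevel, if_neg (by simpa using hk)]
  have hmain := det_le_prod_of_triangular (a := 1 / σ ^ 2) (s := N) (by positivity) hN'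
    (dimLevel_nonneg hN hn hp hord) (fun j : StreamIndex n => hP.1 j.1 j.2)
    (fun j => (userLevel_pos hN hn hp hord j.1).le) hcol htri hbal
  rw [hdet] at hmain
  exact ⟨hmain.1, fun h k l => hmain.2 h ⟨k, l⟩⟩

/-- The caps of a saturated user's streams add up to exactly `p k`, which leaves no slack. -/
theorem power_eq_div_of_lt (hn : ∀ k, 0 < n k) {P : (k : Fin K) → Fin (n k) → ℝ}
    (hP : FeasiblePower n p P) (hle : ∀ k l, P k l ≤ userLevel N n p k) {k : Fin K}
    (hk : (k : ℕ) < K₂ N n p) (l : Fin (n k)) : P k l = p k / n k := by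
  have hlev : userLevel N n p k = p k / n k := by rw [userLevel, if_pos hk]
  rw [← hlev]
  refine (Finset.sum_eq_sum_iff_of_le fun l (_ : l ∈ Finset.univ) => hle k l).1 ?_ l
    (Finset.mem_univ l)
  have : (n k : ℝ) ≠ 0 := by exact_mod_cast (hn k).ne'
  rw [hP.2, hlev]
  simp only [Finset.sum_const, Finset.card_univ, Fintype.card_fin, nsmul_eq_mul]
  field_simp

/-- Orthonormal rows with prescribed column energies, scaled by the level of the tail. -/
theorem exists_tail_rows (hN : 0 < N) (hn : ∀ k, 0 < n k) (hp : ∀ k, 0 < p k)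
    (hord : Antitone fun k => p k / (n k : ℝ)) {R : ℕ} (hR : (R : ℝ) = tailDim N n p)
    {P : (k : Fin K) → Fin (n k) → ℝ} (hP : FeasiblePower n p P)
    (hle : ∀ k l, P k l ≤ userLevel N n p k) :
    ∃ V : Matrix (Fin R) {j : StreamIndex n // ¬ (j.1 : ℕ) < K₂ N n p} ℝ,
      (∀ r r', tailPower N n p / tailDim N n p * ∑ j, V r j * V r' j
        = if r = r' then tailPower N n p / tailDim N n p else 0) ∧
      ∀ j, tailPower N n p / tailDim N n p * ∑ r, V r j ^ 2 = P j.1.1 j.1.2 := by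
  set τ := tailPower N n p / tailDim N n p with hτ
  have hτ0 : 0 ≤ τ := level_nonneg hN hn hp hord
  have hle' : ∀ j : {j : StreamIndex n // ¬ (j.1 : ℕ) < K₂ N n p}, P j.1.1 j.1.2 ≤ τ := fun j => by
    have := hle j.1.1 j.1.2
    rwa [userLevel, if_neg j.2] at this
  by_cases h0 : τ = 0
  · refine ⟨0, by simp [h0], fun j => ?_⟩
    have := hle' j
    have := hP.1 j.1.1 j.1.2
    rw [h0, zero_mul]
    linarith
  have hsum : ∑ j : {j : StreamIndex n // ¬ (j.1 : ℕ) < K₂ N n p}, P j.1.1 j.1.2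
      = tailPower N n p := by
    rw [← Finset.sum_subtype (Finset.univ.filter fun j : StreamIndex n => ¬ (j.1 : ℕ) < K₂ N n p)
      (by simp) (fun j => P j.1 j.2), Finset.sum_filter, Fintype.sum_sigma, tailPower,
      Finset.sum_filter]
    refine Finset.sum_congr rfl fun k _ => ?_
    by_cases hk : (k : ℕ) < K₂ N n p
    · simp [hk]
    · simp [hk, not_lt.1 hk, hP.2]
  -- The level cap puts the ratios `P / τ` in `[0, 1]`, and they add up to `R`.
  obtain ⟨V, hV, hVc⟩ := exists_rows_orthonormal_of_column_energies R
    (fun j : {j : StreamIndex n // ¬ (j.1 : ℕ) < K₂ N n p} => P j.1.1 j.1.2 / τ)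
    (fun j => div_nonneg (hP.1 _ _) hτ0) (fun j => div_le_one_of_le₀ (hle' j) hτ0) (by
      rw [← Finset.sum_div, hsum, div_eq_iff h0, hR, tailDim_mul_level hN hn hp hord])
  refine ⟨V, fun r r' => ?_, fun j => ?_⟩
  · have := congrFun (congrFun hV r) r'
    rw [mul_apply, one_apply] at this
    simp only [transpose_apply] at this
    rw [this]
    simp
  · rw [hVc, mul_div_cancel₀ _ h0]

/-- A Gram-type factor with diagonal row Gram matrix and the stream powers as column energies. -/
theorem exists_factor (hN : 0 < N) (hn : ∀ k, 0 < n k) (hp : ∀ k, 0 < p k)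
    (hord : Antitone fun k => p k / (n k : ℝ)) {R : ℕ} (hR : (R : ℝ) = tailDim N n p)
    {P : (k : Fin K) → Fin (n k) → ℝ} (hP : FeasiblePower n p P)
    (hle : ∀ k l, P k l ≤ userLevel N n p k) :
    ∃ T : Matrix (DimIndex N n p R) (StreamIndex n) ℝ,
      (∀ i i', ∑ j, T i j * T i' j = if i = i' then dimLevel N n p R i else 0) ∧
      ∀ j, ∑ i, T i j ^ 2 = P j.1 j.2 := by
  classical
  obtain ⟨V, hV, hVc⟩ := exists_tail_rows hN hn hp hord hR hP hle
  set τ := tailPower N n p / tailDim N n p with hτ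
  have hτ0 : 0 ≤ τ := level_nonneg hN hn hp hord
  have hPeq : ∀ (k : Fin K) l, (k : ℕ) < K₂ N n p → P k l = userLevel N n p k := fun k l hk => by
    rw [power_eq_div_of_lt hn hP hle hk, userLevel, if_pos hk]
  -- Block diagonal: saturated streams on their own axes, tail streams through `√τ * V`.
  let T : Matrix (DimIndex N n p R) (StreamIndex n) ℝ := of fun i j =>
    Sum.elim (fun j' => if j'.1 = j then √(P j.1 j.2) else 0)
      (fun r => if hj : ¬ (j.1 : ℕ) < K₂ N n p then √τ * V r ⟨j, hj⟩ else 0) i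
  have hTl : ∀ j' j, T (Sum.inl j') j = if j'.1 = j then √(P j.1 j.2) else 0 := fun _ _ => rfl
  have hTr : ∀ r j, T (Sum.inr r) j
      = if hj : ¬ (j.1 : ℕ) < K₂ N n p then √τ * V r ⟨j, hj⟩ else 0 := fun _ _ => rfl
  refine ⟨T, ?_, fun j => ?_⟩
  · rintro (j₁ | r) (j₂ | r')
    · simp only [hTl, ite_mul, zero_mul, Finset.sum_ite_eq, Finset.mem_univ, if_true, Sum.inl.injEq]
      by_cases h : j₁ = j₂
      · subst h
        rw [if_pos rfl, if_pos rfl, Real.mul_self_sqrt (hP.1 _ _), hPeq _ _ j₁.2]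
        rfl
      · rw [if_neg h, if_neg fun h' => h (Subtype.ext h'.symm), mul_zero]
    · simp only [hTl, hTr, ite_mul, zero_mul, Finset.sum_ite_eq, Finset.mem_univ, if_true]
      rw [dif_neg (not_not.2 j₁.2), mul_zero]
      simp
    · simp only [hTl, hTr, mul_ite, mul_zero, Finset.sum_ite_eq, Finset.mem_univ, if_true]
      rw [dif_neg (not_not.2 j₂.2), zero_mul]
      simp
    · rw [← Fintype.sum_subtype_add_sum_subtype fun j : StreamIndex n => (j.1 : ℕ) < K₂ N n p,
        Finset.sum_eq_zero, zero_add]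
      · have h1 : ∀ j : {j : StreamIndex n // ¬ (j.1 : ℕ) < K₂ N n p},
            T (Sum.inr r) j * T (Sum.inr r') j = τ * (V r j * V r' j) := fun j => by
          rw [hTr, hTr, dif_pos j.2, dif_pos j.2, mul_mul_mul_comm, Real.mul_self_sqrt hτ0]
        simp only [h1, ← Finset.mul_sum, hV, Sum.inr.injEq]
        rfl
      · intro j _
        rw [hTr, dif_neg (not_not.2 j.2), zero_mul]
  · rw [Fintype.sum_sum_type]
    by_cases hj : (j.1 : ℕ) < K₂ N n p
    · rw [Fintype.sum_eq_single (⟨j, hj⟩ : {j : StreamIndex n // (j.1 : ℕ) < K₂ N n p}),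
        Finset.sum_eq_zero, hTl, if_pos rfl, Real.sq_sqrt (hP.1 _ _), add_zero]
      · intro r _
        rw [hTr, dif_neg (not_not.2 hj), zero_pow two_ne_zero]
      · intro j' hj'
        rw [hTl, if_neg fun h => hj' (Subtype.ext h), zero_pow two_ne_zero]
    · rw [Finset.sum_eq_zero, zero_add, ← hVc ⟨j, hj⟩, Finset.mul_sum]
      · refine Finset.sum_congr rfl fun r _ => ?_
        rw [hTr, dif_pos hj, mul_pow, Real.sq_sqrt hτ0]
      · intro j' _
        rw [hTl, if_neg (by rintro rfl; exact hj j'.2), zero_pow two_ne_zero]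

/-- Signature sequences that achieve the optimal levels. -/
theorem exists_signatures (hN : 0 < N) (hn : ∀ k, 0 < n k) (hp : ∀ k, 0 < p k)
    (hord : Antitone fun k => p k / (n k : ℝ)) {R : ℕ} (hR : (R : ℝ) = tailDim N n p)
    {P : (k : Fin K) → Fin (n k) → ℝ} (hP : FeasiblePower n p P)
    (hle : ∀ k l, P k l ≤ userLevel N n p k) :
    ∃ S : Matrix (Fin N) (StreamIndex n) ℝ, FeasibleSignatures N n S ∧
      (1 + (1 / σ ^ 2) • (S * diagonal (fun j : StreamIndex n => P j.1 j.2) * Sᵀ)).det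
        = ∏ i, (1 + 1 / σ ^ 2 * N * dimLevel N n p R i) := by
  classical
  obtain ⟨T, hT, hTc⟩ := exists_factor hN hn hp hord hR hP hle
  let e : DimIndex N n p R ≃ Fin N := Fintype.equivFinOfCardEq (card_dimIndex hR)
  -- Columns of `T` are rescaled from energy `P` to `N`. A silent stream has a zero column and gets
  -- an arbitrary vector of energy `N`.
  let S : Matrix (Fin N) (StreamIndex n) ℝ := of fun r j =>
    if P j.1 j.2 = 0 then (if r = ⟨0, hN⟩ then √N else 0) else √(N / P j.1 j.2) * T (e.symm r) j
  have hSP : ∀ r r' j, S r j * P j.1 j.2 * S r' j = N * (T (e.symm r) j * T (e.symm r') j) := by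
    intro r r' j
    simp only [S, of_apply]
    by_cases h0 : P j.1 j.2 = 0
    · have h1 := hTc j
      rw [h0, Finset.sum_eq_zero_iff_of_nonneg fun i _ => sq_nonneg _] at h1
      have h2 := pow_eq_zero_iff two_ne_zero |>.1 (h1 (e.symm r) (Finset.mem_univ _))
      simp [h0, h2]
    · have h1 : (0 : ℝ) ≤ N / P j.1 j.2 := div_nonneg N.cast_nonneg (hP.1 _ _)
      rw [if_neg h0, if_neg h0]
      have h2 : √(N / P j.1 j.2) * √(N / P j.1 j.2) * P j.1 j.2 = N := by
        rw [Real.mul_self_sqrt h1, div_mul_cancel₀ _ h0]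
      linear_combination (T (e.symm r) j * T (e.symm r') j) * h2
  refine ⟨S, fun j => ?_, ?_⟩
  · simp only [S, of_apply]
    by_cases h0 : P j.1 j.2 = 0
    · simp [h0]
    · simp only [if_neg h0, mul_pow, ← Finset.mul_sum]
      rw [Equiv.sum_comp e.symm fun i => T i j ^ 2, hTc,
        Real.sq_sqrt (div_nonneg N.cast_nonneg (hP.1 _ _)), div_mul_cancel₀ _ h0]
  · have hdiag : 1 + (1 / σ ^ 2) • (S * diagonal (fun j : StreamIndex n => P j.1 j.2) * Sᵀ)
        = diagonal fun r => 1 + 1 / σ ^ 2 * N * dimLevel N n p R (e.symm r) := by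
      ext r r'
      rw [Matrix.add_apply, Matrix.smul_apply, mul_apply, smul_eq_mul]
      simp only [mul_diagonal, transpose_apply, hSP]
      rw [← Finset.mul_sum, hT, one_apply, diagonal_apply]
      simp only [EmbeddingLike.apply_eq_iff_eq]
      split_ifs <;> ring
    rw [hdiag, det_diagonal]
    exact Equiv.prod_comp e.symm fun i => 1 + 1 / σ ^ 2 * N * dimLevel N n p R i

/-- The optimal power distributions are those that respect the levels of the users. -/
theorem isOptimalPower_iff (hN : 0 < N) (hn : ∀ k, 0 < n k) (hp : ∀ k, 0 < p k) (hσ : 0 < σ)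
    (hord : Antitone fun k => p k / (n k : ℝ)) (P : (k : Fin K) → Fin (n k) → ℝ) :
    IsOptimalPower N n p σ P ↔ FeasiblePower n p P ∧ ∀ k l, P k l ≤ userLevel N n p k := by
  obtain ⟨R, hR⟩ := exists_nat_eq_tailDim hN hn hp hord
  have hpos : ∀ {P : (k : Fin K) → Fin (n k) → ℝ} {S : Matrix (Fin N) (StreamIndex n) ℝ},
      FeasiblePower n p P →
      0 < (1 + (1 / σ ^ 2) • (S * diagonal (fun j : StreamIndex n => P j.1 j.2) * Sᵀ)).det :=
    fun {P S} hP =>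
      (posDef_one_add_smul (by positivity) (fun j : StreamIndex n => hP.1 j.1 j.2) S).det_pos
  have hN' : (0 : ℝ) < 1 / (2 * N) := by positivity
  constructor
  · rintro ⟨S, hP, hS, hmax⟩
    refine ⟨hP, ?_⟩
    -- The even split respects the levels, so it shows that the determinant bound is the maximum.
    have hP₀ : FeasiblePower n p fun k _ => p k / n k := by
      refine ⟨fun k l => div_nonneg (hp k).le (Nat.cast_nonneg _), fun k => ?_⟩
      have : (n k : ℝ) ≠ 0 := by exact_mod_cast (hn k).ne'
      simp only [Finset.sum_const, Finset.card_univ, Fintype.card_fin, nsmul_eq_mul]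
      field_simp
    obtain ⟨S₀, hS₀, hdet⟩ := exists_signatures (σ := σ) hN hn hp hord hR hP₀
      fun k _ => div_le_userLevel hN hn hp hord k
    have h1 := hmax _ S₀ hP₀ hS₀
    rw [sumRate, sumRate, mul_le_mul_iff_right₀ hN',
      Real.logb_le_logb one_lt_two (hpos hP₀) (hpos hP), hdet] at h1
    have h2 := det_le_prod_dimLevel hN hn hp hσ hord hR hP hS
    exact h2.2 (le_antisymm h2.1 h1)
  · rintro ⟨hP, hle⟩
    obtain ⟨S, hS, hdet⟩ := exists_signatures (σ := σ) hN hn hp hord hR hP hle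
    refine ⟨S, hP, hS, fun P' S' hP' hS' => ?_⟩
    rw [sumRate, sumRate, mul_le_mul_iff_right₀ hN',
      Real.logb_le_logb one_lt_two (hpos hP') (hpos hP), hdet]
    exact (det_le_prod_dimLevel hN hn hp hσ hord hR hP' hS').1

end

/-! ### From bandwidth profiles to power distributions -/

section

variable {K : ℕ} {N : ℕ} {n : Fin K → ℕ} {p : Fin K → ℝ} {σ : ℝ}

/-- Optimal power distributions come from optimal bandwidth profiles. -/
theorem isOptimalPower_iff_exists_bandwidth (hN : 0 < N) (hn : ∀ k, 0 < n k) (hp : ∀ k, 0 < p k)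
    (hσ : 0 < σ) (hord : Antitone fun k => p k / (n k : ℝ)) (P : (k : Fin K) → Fin (n k) → ℝ) :
    IsOptimalPower N n p σ P ↔
      ∃ w : (k : Fin K) → Fin (n k) → ℝ, IsOptimalBandwidth N n p σ w ∧
        ∀ k l, P k l =
          if (k : ℕ) < K₂ N n p then p k / (n k : ℝ)
          else (w k l / wStar N n p k) * p k := by
  have hN' : (0 : ℝ) < N := by positivity
  have hw := wStar_pos hN hn hp hord
  have hlev := userLevel_pos hN hn hp hord
  have hwl := wStar_eq hN hn hp hord
  simp only [isOptimalPower_iff hN hn hp hσ hord, isOptimalBandwidth_iff hN hn hp hσ hord]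
  constructor
  · rintro ⟨hP, hle⟩
    -- This witness equals `P k l / (2 N level)`, so the box constraint is the level cap.
    refine ⟨fun k l => P k l * wStar N n p k / p k, ⟨fun k l => ⟨?_, ?_⟩, fun k => ?_⟩,
      fun k l => ?_⟩
    · exact div_nonneg (mul_nonneg (hP.1 k l) (hw k).le) (hp k).le
    · have h1 := hle k l
      have h2 := hlev k
      have h3 := hp k
      have h4 : P k l * wStar N n p k / p k = P k l / userLevel N n p k * (1 / (2 * N)) := by
        rw [hwl]
        field_simp
      exact h4.trans_le <| mul_le_of_le_one_left (by positivity) (div_le_one_of_le₀ h1 h2.le)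
    · rw [← Finset.sum_div, ← Finset.sum_mul, hP.2, mul_div_cancel_left₀ _ (hp k).ne']
    · split_ifs with hk
      · exact power_eq_div_of_lt hn hP hle hk l
      · have h1 := (hw k).ne'
        have h2 := (hp k).ne'
        field_simp
  · rintro ⟨w, ⟨hbox, hsum⟩, hPw⟩
    refine ⟨⟨fun k l => ?_, fun k => ?_⟩, fun k l => ?_⟩
    · rw [hPw]
      split_ifs
      · exact div_nonneg (hp k).le (Nat.cast_nonneg _)
      · exact mul_nonneg (div_nonneg (hbox k l).1 (hw k).le) (hp k).le
    · simp only [hPw]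
      split_ifs
      · have : (n k : ℝ) ≠ 0 := by exact_mod_cast (hn k).ne'
        simp only [Finset.sum_const, Finset.card_univ, Fintype.card_fin, nsmul_eq_mul]
        field_simp
      · rw [← Finset.sum_mul, ← Finset.sum_div, hsum, div_self (hw k).ne', one_mul]
    · rw [hPw]
      split_ifs with hk
      · exact div_le_userLevel hN hn hp hord k
      · have h1 := (hbox k l).2
        have h2 := hlev k
        have h3 := hp k
        have h4 : w k l / wStar N n p k * p k = w k l * (2 * N) * userLevel N n p k := by
          rw [hwl]
          field_simp
        rw [h4]
        refine mul_le_of_le_one_left h2.le ?_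
        rwa [le_div_iff₀ (by positivity)] at h1

theorem activeStreams_eq_sum_sign {P : (k : Fin K) → Fin (n k) → ℝ} {k : Fin K}
    (hP : ∀ l, 0 ≤ P k l) : (activeStreams n P k : ℝ) = ∑ l, Real.sign (P k l) := by
  classical
  rw [activeStreams, Nat.card_eq_fintype_card, Fintype.card_subtype, ← Finset.sum_boole]
  refine Finset.sum_congr rfl fun l _ => ?_
  rcases (hP l).eq_or_lt with h | h
  · simp [← h]
  · rw [if_pos h, Real.sign_of_pos h]

end

theorem theorem3 {K : ℕ} (N : ℕ) (n : Fin K → ℕ) (p : Fin K → ℝ) (σ : ℝ)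
    (hN : 0 < N) (hn : ∀ k, 0 < n k) (hp : ∀ k, 0 < p k) (hσ : 0 < σ)
    (hord : Antitone fun k => p k / (n k : ℝ)) :
    (∀ w : (k : Fin K) → Fin (n k) → ℝ, IsOptimalBandwidth N n p σ w ↔
      (∀ k l, 0 ≤ w k l ∧ w k l ≤ 1 / (2 * (N : ℝ))) ∧ ∀ k, ∑ l, w k l = wStar N n p k) ∧
    (∀ P : (k : Fin K) → Fin (n k) → ℝ, IsOptimalPower N n p σ P ↔
      ∃ w : (k : Fin K) → Fin (n k) → ℝ, IsOptimalBandwidth N n p σ w ∧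
        ∀ k l, P k l =
          if (k : ℕ) < K₂ N n p then p k / (n k : ℝ)
          else (w k l / wStar N n p k) * p k) ∧
    (∀ P : (k : Fin K) → Fin (n k) → ℝ, IsOptimalPower N n p σ P →
      ∀ k, (activeStreams n P k : ℝ) =
        if (k : ℕ) < K₂ N n p then (n k : ℝ) else ∑ l, Real.sign (P k l)) := by
  refine ⟨isOptimalBandwidth_iff hN hn hp hσ hord,
    isOptimalPower_iff_exists_bandwidth hN hn hp hσ hord, fun P hP k => ?_⟩
  obtain ⟨hP, hle⟩ := (isOptimalPower_iff hN hn hp hσ hord P).1 hP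
  rw [activeStreams_eq_sum_sign (hP.1 k)]
  split_ifs with hk
  · have hpos : 0 < p k / n k := div_pos (hp k) (by exact_mod_cast hn k)
    simp [power_eq_div_of_lt hn hP hle hk, Real.sign_of_pos hpos]
  · rfl
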